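/- Let $n\ge 2$ and let $k\ge 0$ be integers. The Painter–Builder proper $k$-colouring game on $[n]=\{1,\dots,n\}$ is the following perfect information game. It starts with the graph on the vertex set $[n]$ that has no edges and no coloured vertices. Painter and Builder take turns, Painter first. In her turn Painter colours a previously uncoloured vertex with one of $k$ given colours; in his turn Builder adds an edge between two distinct, previously non-adjacent vertices (if he has no legal move, he passes). After every move no edge may have both endpoints coloured with the same colour. The game ends as soon as all vertices are coloured, in which case Painter wins, or Painter has no legal move although some vertex is uncoloured, in which case Builder wins. Let $k_{\min}(n)$ be the minimum number $k$ of colours such that Painter has a winning strategy in the $k$-colouring game on $[n]$. **Theorem.** For every integer $n>10^8$, $$0.01\log_2 n < k_{\min}(n)\le \log_2 n+1 .$$ Moreover, for every integer $k\ge 0$ with $k\le 0.01\log_2 n$, Builder has a winning strategy in the $k$-colouring game on $[n]$ that keeps the graph formed by the edges drawn so far bipartite throughout the game. -/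

import Mathlib

namespace PainterBuilder

/-- A position of the game on the vertex set `Fin n` with colours `Fin k`: the game graph together
with a partial colouring of its vertices (`none` means uncoloured). -/
@[ext]
structure Position (n k : ℕ) where
  graph : SimpleGraph (Fin n)
  colour : Fin n → Option (Fin k)

namespace Position

variable {n k : ℕ}

/-- The initial position: no edges, no coloured vertices. -/
def start (n k : ℕ) : Position n k := ⟨⊥, fun _ => none⟩

/-- The (partial) colouring is proper: no edge has both endpoints coloured with the same colour. -/
def IsProper (p : Position n k) : Prop :=
  ∀ u v : Fin n, p.graph.Adj u v → ∀ c : Fin k, ¬ (p.colour u = some c ∧ p.colour v = some c)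

/-- All vertices are coloured. -/
def AllColoured (p : Position n k) : Prop := ∀ v : Fin n, p.colour v ≠ none

/-- `q` arises from `p` by a legal move of Painter: an uncoloured vertex receives one of the `k`
colours, and the result is properly coloured. -/
def PainterMove (p q : Position n k) : Prop :=
  ∃ (v : Fin n) (c : Fin k), p.colour v = none ∧
    q = ⟨p.graph, Function.update p.colour v (some c)⟩ ∧ q.IsProper

/-- `q` arises from `p` by a legal move of Builder: an edge is added between two distinct vertices
that were not adjacent before, and the result is properly coloured. -/
def BuilderMove (p q : Position n k) : Prop :=
  ∃ u v : Fin n, u ≠ v ∧ ¬ p.graph.Adj u v ∧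
    q = ⟨p.graph ⊔ SimpleGraph.edge u v, p.colour⟩ ∧ q.IsProper

/-- The game is over: all vertices are coloured, or Painter has no legal move. -/
def Ended (p : Position n k) : Prop := p.AllColoured ∨ ¬ ∃ q, p.PainterMove q

end Position

/-- A strategy of Painter. It may depend on the whole history: `move h p` is the position she moves
to when the current position is `p` and the earlier positions, latest first, are `h`. The move has
to be legal whenever she has a legal move. -/
structure PainterStrategy (n k : ℕ) where
  move : List (Position n k) → Position n k → Position n k
  legal : ∀ (h : List (Position n k)) (p : Position n k), (∃ q, p.PainterMove q) → p.PainterMove (move h p)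

/-- A strategy of Builder, likewise. -/
structure BuilderStrategy (n k : ℕ) where
  move : List (Position n k) → Position n k → Position n k
  legal : ∀ (h : List (Position n k)) (p : Position n k), (∃ q, p.BuilderMove q) → p.BuilderMove (move h p)

open Classical in
/-- The position after Painter (if `painterTurn`) or Builder has moved from `p` with history `h`.
Nothing changes once the game is over. While the game is not over Painter has a legal move;
if Builder has none on his turn, he passes. -/
noncomputable def next {n k : ℕ} (σ : PainterStrategy n k) (τ : BuilderStrategy n k)
    (painterTurn : Prop) (h : List (Position n k)) (p : Position n k) : Position n k :=
  if p.Ended then p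
  else if painterTurn then σ.move h p
  else if ∃ q, p.BuilderMove q then τ.move h p
  else p

/-- The play of `σ` against `τ` after `i` turns: the list of earlier positions, latest first, and
the current position. Painter moves at the even times `0, 2, 4, …`, Builder at the odd ones. -/
noncomputable def run {n k : ℕ} (σ : PainterStrategy n k) (τ : BuilderStrategy n k) :
    ℕ → List (Position n k) × Position n k
  | 0 => ([], Position.start n k)
  | i + 1 => ((run σ τ i).2 :: (run σ τ i).1, next σ τ (Even i) (run σ τ i).1 (run σ τ i).2)

/-- The position after `i` turns (the final position, if the game has ended before). -/
noncomputable def position {n k : ℕ} (σ : PainterStrategy n k) (τ : BuilderStrategy n k) (i : ℕ) :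
    Position n k := (run σ τ i).2

/-- Painter wins the play: it reaches a position with all vertices coloured. -/
def PainterWinsPlay {n k : ℕ} (σ : PainterStrategy n k) (τ : BuilderStrategy n k) : Prop :=
  ∃ i, (position σ τ i).AllColoured

/-- Builder wins the play: it ends in a position where not all vertices are coloured and Painter
has no legal move. -/
def BuilderWinsPlay {n k : ℕ} (σ : PainterStrategy n k) (τ : BuilderStrategy n k) : Prop :=
  ∃ i, ¬ (position σ τ i).AllColoured ∧ ¬ ∃ q, (position σ τ i).PainterMove q

/-- Painter has a winning strategy in the `k`-colouring game on `n` vertices. -/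
def PainterWins (n k : ℕ) : Prop :=
  ∃ σ : PainterStrategy n k, ∀ τ : BuilderStrategy n k, PainterWinsPlay σ τ

/-- The minimum number of colours such that Painter has a winning strategy on `n` vertices
(`n` colours always suffice, so the set is not empty). -/
noncomputable def kMin (n : ℕ) : ℕ := sInf {k : ℕ | PainterWins n k}

end PainterBuilder

/-!
The upper bound. If `n < 2 ^ k`, then Painter keeps the uncoloured vertices independent
and bounds `∑ 2 ^ |seen v|` over them by `2 ^ k`, where `seen v` is the set of colours on the
neighbours of `v`. If Builder joins two uncoloured vertices that see different sets, one of them can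
take a colour that the other one sees already; if they see the same set, colouring one doubles the
weight of the other and the sum does not grow; and an uncoloured vertex that Builder joins to
a coloured one is coloured at once. This alone would lose a factor of two. It is regained by
demanding that no two vertices see the same `k - 2` colours (`Safe`): among the colours that Painter
may choose for a vertex that sees `k - 3` colours, one keeps this up, because otherwise the weights
would already add up to `2 ^ k` (`Safe.exists_colour`). So no vertex ever sees `k - 1` colours after
Painter's move (`Safe.exists_move`).

The lower bound. Builder always joins two components, one endpoint being uncoloured. So the graph is
a forest, and there are always more components than uncoloured vertices when he is to move
(`Layout`). Hence he can wait without damage: he may merge a component of no use to him into another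
one (`Layout.exists_waiting_move`). Suppose that `N` components each contain an uncoloured vertex that
sees at least `j` colours, among them those of a set `I`. Up to `2 ^ k` of them, these vertices can be
joined in pairs that see the same colours; Painter needs two moves to destroy a pair, and a pair that
she touches once contains a vertex that sees one more colour. So either a constant proportion of `N`
has got one more colour, or there remain many untouched pairs (`builderForces_of_vertices`). Then
Builder waits until half of these have been touched (`builderForces_of_pairs`). The colours that
Painter used in touching them are not in `I`, and Builder joins the untouched pairs to vertices with
these colours, one in each round, faster than Painter can destroy the pairs. Either this gives many
vertices with one more colour, or some colour outside `I` is seen by all the remaining pairs, and may be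
added to `I` (`builderForces_of_supply`). Thus `j + |I| ≤ 2 k` increases at the cost of a constant
factor, and as soon as `j = k` some vertex can never be coloured (`builderForcesFrom_of_le`).
Measuring progress by `I` as well is what keeps the total loss exponential in `k`: choosing the most
frequent colour at each of the `k` levels would cost a factor of the order of `k!`.
-/

namespace PainterBuilder

/-! ### Positions and moves -/

namespace Position

variable {n k : ℕ}

open Classical in
/-- The colours on the neighbours of `v`: the colours that Painter may not give to `v`. -/
noncomputable def seen (p : Position n k) (v : Fin n) : Finset (Fin k) :=
  Finset.univ.filter fun c => ∃ w, p.graph.Adj v w ∧ p.colour w = some c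

open Classical in
/-- The set of uncoloured vertices. -/
noncomputable def uncoloured (p : Position n k) : Finset (Fin n) :=
  Finset.univ.filter fun v => p.colour v = none

/-- The position after `v` has received the colour `c`. -/
def paint (p : Position n k) (v : Fin n) (c : Fin k) : Position n k :=
  ⟨p.graph, Function.update p.colour v (some c)⟩

/-- The position after the edge between `u` and `v` has been added. -/
def join (p : Position n k) (u v : Fin n) : Position n k :=
  ⟨p.graph ⊔ SimpleGraph.edge u v, p.colour⟩

theorem mem_seen {p : Position n k} {v : Fin n} {c : Fin k} :
    c ∈ p.seen v ↔ ∃ w, p.graph.Adj v w ∧ p.colour w = some c := by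
  simp [seen]

theorem mem_uncoloured {p : Position n k} {v : Fin n} :
    v ∈ p.uncoloured ↔ p.colour v = none := by
  simp [uncoloured]

theorem not_allColoured {p : Position n k} {v : Fin n} (h : p.colour v = none) :
    ¬ p.AllColoured := fun h' => h' v h

theorem exists_uncoloured {p : Position n k} (h : ¬ p.AllColoured) : ∃ v, p.colour v = none := by
  simpa [AllColoured] using h

theorem paint_colour_self (p : Position n k) (v : Fin n) (c : Fin k) :
    (p.paint v c).colour v = some c := by
  simp [paint]

theorem paint_colour_of_ne (p : Position n k) {v w : Fin n} (c : Fin k) (h : w ≠ v) :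
    (p.paint v c).colour w = p.colour w := by
  simp [paint, h]

theorem uncoloured_paint (p : Position n k) (v : Fin n) (c : Fin k) :
    (p.paint v c).uncoloured = p.uncoloured.erase v := by
  ext w
  by_cases h : w = v
  · subst h
    simp [mem_uncoloured, paint_colour_self]
  · simp [mem_uncoloured, paint_colour_of_ne p c h, h]

theorem card_uncoloured_paint {p : Position n k} {v : Fin n} (c : Fin k) (h : p.colour v = none) :
    (p.paint v c).uncoloured.card + 1 = p.uncoloured.card := by
  rw [uncoloured_paint, Finset.card_erase_add_one (mem_uncoloured.2 h)]

theorem isProper_paint {p : Position n k} (hp : p.IsProper) {v : Fin n} {c : Fin k}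
    (hc : c ∉ p.seen v) : (p.paint v c).IsProper := by
  intro a b hab d hd
  by_cases ha : a = v <;> by_cases hb : b = v
  · subst ha; subst hb
    exact hab.ne rfl
  · subst ha
    rw [paint_colour_self, paint_colour_of_ne p c hb] at hd
    obtain ⟨h1, h2⟩ := hd
    cases h1
    exact hc (mem_seen.2 ⟨b, hab, h2⟩)
  · subst hb
    rw [paint_colour_self, paint_colour_of_ne p c ha] at hd
    obtain ⟨h1, h2⟩ := hd
    cases h2
    exact hc (mem_seen.2 ⟨a, hab.symm, h1⟩)
  · rw [paint_colour_of_ne p c ha, paint_colour_of_ne p c hb] at hd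
    exact hp a b hab d hd

theorem notMem_seen_of_isProper_paint {p : Position n k} {v : Fin n} {c : Fin k}
    (h : (p.paint v c).IsProper) : c ∉ p.seen v := by
  intro hc
  obtain ⟨w, hw, hwc⟩ := mem_seen.1 hc
  refine h v w hw c ⟨paint_colour_self p v c, ?_⟩
  rw [paint_colour_of_ne p c hw.ne', hwc]

theorem painterMove_paint {p : Position n k} (hp : p.IsProper) {v : Fin n} {c : Fin k}
    (hv : p.colour v = none) (hc : c ∉ p.seen v) : p.PainterMove (p.paint v c) :=
  ⟨v, c, hv, rfl, isProper_paint hp hc⟩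

theorem join_adj {p : Position n k} {x y a b : Fin n} :
    (p.join x y).graph.Adj a b ↔
      p.graph.Adj a b ∨ (a ≠ b ∧ ((a = x ∧ b = y) ∨ (a = y ∧ b = x))) := by
  simp only [join, SimpleGraph.sup_adj, SimpleGraph.edge_adj]
  tauto

/-- An edge at an uncoloured vertex never spoils properness. -/
theorem isProper_join {p : Position n k} (hp : p.IsProper) {x y : Fin n}
    (hx : p.colour x = none) : (p.join x y).IsProper := by
  intro a b hab d hd
  rcases join_adj.1 hab with h | ⟨-, ⟨rfl, rfl⟩ | ⟨rfl, rfl⟩⟩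
  · exact hp a b h d hd
  · have := hd.1
    simp [join, hx] at this
  · have := hd.2
    simp [join, hx] at this

theorem builderMove_join {p : Position n k} (hp : p.IsProper) {x y : Fin n} (hxy : x ≠ y)
    (h : ¬ p.graph.Adj x y) (hx : p.colour x = none) : p.BuilderMove (p.join x y) :=
  ⟨x, y, hxy, h, rfl, isProper_join hp hx⟩

theorem seen_mono {p q : Position n k} (hg : p.graph ≤ q.graph)
    (hc : ∀ v c, p.colour v = some c → q.colour v = some c) (v : Fin n) : p.seen v ⊆ q.seen v := by
  intro c h
  obtain ⟨w, hw, hwc⟩ := mem_seen.1 h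
  exact mem_seen.2 ⟨w, hg hw, hc w c hwc⟩

theorem uncoloured_join (p : Position n k) (x y : Fin n) :
    (p.join x y).uncoloured = p.uncoloured := rfl

theorem isProper_start : (start n k).IsProper := by
  intro u v h
  exact absurd h (by simp [start])

end Position

open Position

variable {n k : ℕ}

/-! ### Builder's bookkeeping -/

/-- Builder can force a win from the position `p`, in which Painter is to move, while the graph stays
bipartite: he has an answer `f q` to every Painter move to `q` that leads to
a position of the same kind. The predicate is inductive, so the play comes to an end, which can only
be for want of a Painter move; and the position is then not completely coloured. -/
inductive BuilderForces : Position n k → Prop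
  | intro (p : Position n k) (bipartite : p.graph.IsBipartite) (notAll : ¬ p.AllColoured)
      (f : Position n k → Position n k) (legal : ∀ q, p.PainterMove q → q.BuilderMove (f q))
      (forces : ∀ q, p.PainterMove q → BuilderForces (f q)) : BuilderForces p

/-- Bookkeeping for a forest-like play of Builder. The labelling `comp` is constant on the connected
components, each of which is two-coloured by `side`; and there are at least `d` more labels than
uncoloured vertices. Builder only ever merges two labels, so that `d = 0` when Painter is to move
and `d = 1` when Builder is. -/
structure Layout (p : Position n k) (comp : Fin n → Fin n) (d : ℕ) : Prop where
  proper : p.IsProper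
  sides : ∃ side : Fin n → Bool, ∀ u v, p.graph.Adj u v → comp u = comp v ∧ side u ≠ side v
  count : p.uncoloured.card + d ≤ (Finset.univ.image comp).card

/-- The labelling in which the label `b` has been absorbed by the label `a`. -/
def absorb (comp : Fin n → Fin n) (a b : Fin n) : Fin n → Fin n :=
  fun z => if comp z = b then a else comp z

/-- The component labelled `a` contains an uncoloured vertex that sees at least `j` colours, among
them all those of `I`. -/
def HasVertex (p : Position n k) (comp : Fin n → Fin n) (j : ℕ) (I : Finset (Fin k))
    (a : Fin n) : Prop :=
  ∃ w, comp w = a ∧ p.colour w = none ∧ j ≤ (p.seen w).card ∧ I ⊆ p.seen w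

/-- `u`, `v` are adjacent uncoloured vertices in the component labelled `a` that both see all the
colours of `A`, where `A` contains `I` and has at least `j` elements; and `u` sees at least `i`
colours. -/
structure IsPair (p : Position n k) (comp : Fin n → Fin n) (j i : ℕ) (I : Finset (Fin k))
    (a u v : Fin n) (A : Finset (Fin k)) : Prop where
  label_left : comp u = a
  label_right : comp v = a
  left : p.colour u = none
  right : p.colour v = none
  adj : p.graph.Adj u v
  card : j ≤ A.card
  base : I ⊆ A
  seen_left : A ⊆ p.seen u
  seen_right : A ⊆ p.seen v
  card_left : i ≤ (p.seen u).card

/-- The component labelled `a` contains a pair in the sense of `IsPair`. -/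
def HasPair (p : Position n k) (comp : Fin n → Fin n) (j i : ℕ) (I : Finset (Fin k))
    (a : Fin n) : Prop :=
  ∃ u v A, IsPair p comp j i I a u v A

/-- The component labelled `a` contains a vertex whose colour is not in `I`. -/
def HasSupply (p : Position n k) (comp : Fin n → Fin n) (I : Finset (Fin k)) (a : Fin n) : Prop :=
  ∃ y c, comp y = a ∧ p.colour y = some c ∧ c ∉ I

/-- The position has only grown from `p` to `q`, and in the component labelled `a` no vertex has lost
its label or been newly coloured. -/
structure Persists (p : Position n k) (comp : Fin n → Fin n) (q : Position n k)
    (comp' : Fin n → Fin n) (a : Fin n) : Prop where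
  graph : p.graph ≤ q.graph
  colour : ∀ v c, p.colour v = some c → q.colour v = some c
  label : ∀ v, comp v = a → comp' v = a ∧ q.colour v = p.colour v

namespace Persists

variable {p q : Position n k} {comp comp' : Fin n → Fin n} {a : Fin n}

theorem hasVertex (h : Persists p comp q comp' a) {j : ℕ} {I : Finset (Fin k)}
    (H : HasVertex p comp j I a) : HasVertex q comp' j I a := by
  obtain ⟨w, hw, hn, hj, hI⟩ := H
  have hs := seen_mono h.graph h.colour w
  exact ⟨w, (h.label w hw).1, (h.label w hw).2.trans hn, hj.trans (Finset.card_le_card hs),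
    hI.trans hs⟩

theorem isPair (h : Persists p comp q comp' a) {j i : ℕ} {I : Finset (Fin k)} {u v : Fin n}
    {A : Finset (Fin k)} (H : IsPair p comp j i I a u v A) : IsPair q comp' j i I a u v A where
  label_left := (h.label u H.label_left).1
  label_right := (h.label v H.label_right).1
  left := (h.label u H.label_left).2.trans H.left
  right := (h.label v H.label_right).2.trans H.right
  adj := h.graph H.adj
  card := H.card
  base := H.base
  seen_left := H.seen_left.trans (seen_mono h.graph h.colour u)
  seen_right := H.seen_right.trans (seen_mono h.graph h.colour v)
  card_left := H.card_left.trans (Finset.card_le_card (seen_mono h.graph h.colour u))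

theorem hasPair (h : Persists p comp q comp' a) {j i : ℕ} {I : Finset (Fin k)}
    (H : HasPair p comp j i I a) : HasPair q comp' j i I a := by
  obtain ⟨u, v, A, H⟩ := H
  exact ⟨u, v, A, h.isPair H⟩

theorem hasSupply (h : Persists p comp q comp' a) {I : Finset (Fin k)}
    (H : HasSupply p comp I a) : HasSupply q comp' I a := by
  obtain ⟨y, c, hy, hc, hI⟩ := H
  exact ⟨y, c, (h.label y hy).1, h.colour y c hc, hI⟩

end Persists

theorem IsPair.hasVertex {p : Position n k} {comp : Fin n → Fin n} {j i : ℕ} {I : Finset (Fin k)}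
    {a u v : Fin n} {A : Finset (Fin k)} (H : IsPair p comp j i I a u v A) :
    HasVertex p comp i I a :=
  ⟨u, H.label_left, H.left, H.card_left, H.base.trans H.seen_left⟩

theorem paint_colour_of_some {p : Position n k} {v : Fin n} {c : Fin k} (hv : p.colour v = none)
    (w : Fin n) (d : Fin k) (h : p.colour w = some d) : (p.paint v c).colour w = some d := by
  have : w ≠ v := by
    rintro rfl
    simp [hv] at h
  rw [paint_colour_of_ne p c this, h]

/-- A Painter move in another component changes nothing of interest. -/
theorem persists_paint {p : Position n k} {comp : Fin n → Fin n} {v : Fin n} {c : Fin k}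
    (hv : p.colour v = none) {a : Fin n} (ha : comp v ≠ a) :
    Persists p comp (p.paint v c) comp a where
  graph := le_rfl
  colour := paint_colour_of_some hv
  label := fun w hw => ⟨hw, paint_colour_of_ne p c (by rintro rfl; exact ha hw)⟩

theorem hasSupply_paint {p : Position n k} {comp : Fin n → Fin n} {v : Fin n} {c : Fin k}
    (hv : p.colour v = none) {I : Finset (Fin k)} {a : Fin n} (H : HasSupply p comp I a) :
    HasSupply (p.paint v c) comp I a := by
  obtain ⟨y, d, hy, hd, hI⟩ := H
  exact ⟨y, d, hy, paint_colour_of_some hv y d hd, hI⟩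

/-- If Painter colours a vertex of a pair, then the other vertex sees one more colour, and the new
colour is not in `I`. -/
theorem HasPair.paint {p : Position n k} {comp : Fin n → Fin n} {j i : ℕ} {I : Finset (Fin k)}
    {a : Fin n} (H : HasPair p comp j i I a) {v : Fin n} {c : Fin k}
    (hv : p.colour v = none) (hp : (p.paint v c).IsProper) :
    HasPair (p.paint v c) comp j i I a ∨
      (HasVertex (p.paint v c) comp (j + 1) I a ∧ HasSupply (p.paint v c) comp I a) := by
  obtain ⟨x, y, A, H⟩ := H
  have hc := notMem_seen_of_isProper_paint hp
  have hs : ∀ w, p.seen w ⊆ (p.paint v c).seen w :=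
    seen_mono (le_refl p.graph) (paint_colour_of_some hv)
  -- The colour `c` of `v` is new to a neighbour `w` of `v`, as `v` itself sees all of `A`.
  have key : ∀ w, comp v = a → comp w = a → p.colour w = none → p.graph.Adj v w → A ⊆ p.seen v →
      A ⊆ p.seen w →
      HasVertex (p.paint v c) comp (j + 1) I a ∧ HasSupply (p.paint v c) comp I a := by
    intro w hva hwa hw hadj hAv hAw
    have hcA : c ∉ A := fun h => hc (hAv h)
    have hins : insert c A ⊆ (p.paint v c).seen w :=
      Finset.insert_subset (mem_seen.2 ⟨v, hadj.symm, paint_colour_self p v c⟩)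
        (hAw.trans (hs w))
    refine ⟨⟨w, hwa, ?_, ?_, ?_⟩, v, c, hva, paint_colour_self p v c, fun h => hcA (H.base h)⟩
    · rw [paint_colour_of_ne p c hadj.ne', hw]
    · have h2 := Finset.card_le_card hins
      rw [Finset.card_insert_of_notMem hcA] at h2
      have := H.card
      omega
    · exact (H.base.trans hAw).trans (hs w)
  by_cases hx : v = x
  · subst hx
    exact Or.inr (key y H.label_left H.label_right H.right H.adj H.seen_left H.seen_right)
  by_cases hy : v = y
  · subst hy
    exact Or.inr (key x H.label_right H.label_left H.left H.adj.symm H.seen_right H.seen_left)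
  · refine Or.inl ⟨x, y, A, H.label_left, H.label_right, ?_, ?_, H.adj, H.card, H.base,
      H.seen_left.trans (hs x), H.seen_right.trans (hs y),
      H.card_left.trans (Finset.card_le_card (hs x))⟩
    · rw [paint_colour_of_ne p c (Ne.symm hx), H.left]
    · rw [paint_colour_of_ne p c (Ne.symm hy), H.right]

namespace Layout

variable {p : Position n k} {comp : Fin n → Fin n}

theorem isBipartite {d : ℕ} (h : Layout p comp d) : p.graph.IsBipartite := by
  obtain ⟨side, hs⟩ := h.sides
  have C : p.graph.Coloring Bool := SimpleGraph.Coloring.mk side fun {u v} huv => (hs u v huv).2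
  simpa using C.colorable

theorem paint (h : Layout p comp 0) {v : Fin n} {c : Fin k} (hv : p.colour v = none)
    (hp : (p.paint v c).IsProper) : Layout (p.paint v c) comp 1 where
  proper := hp
  sides := h.sides
  count := by
    rw [card_uncoloured_paint c hv]
    exact h.count

theorem not_adj {d : ℕ} (h : Layout p comp d) {x y : Fin n} (hxy : comp x ≠ comp y) :
    ¬ p.graph.Adj x y := by
  obtain ⟨side, hs⟩ := h.sides
  exact fun hadj => hxy (hs x y hadj).1

theorem builderMove {d : ℕ} (h : Layout p comp d) {x y : Fin n} (hx : p.colour x = none)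
    (hxy : comp x ≠ comp y) : p.BuilderMove (p.join x y) :=
  builderMove_join h.proper (fun e => hxy (congrArg comp e)) (h.not_adj hxy) hx

theorem join (h : Layout p comp 1) {x y : Fin n} (hx : p.colour x = none)
    (hxy : comp x ≠ comp y) : Layout (p.join x y) (absorb comp (comp x) (comp y)) 0 where
  proper := isProper_join h.proper hx
  sides := by
    obtain ⟨side, hs⟩ := h.sides
    -- The sides of the absorbed component are swapped if `x` and `y` lie on equal sides.
    refine ⟨fun z => if comp z = comp y then side z ^^ (side x == side y) else side z, ?_⟩
    intro u v huv
    rcases join_adj.1 huv with h1 | ⟨-, ⟨rfl, rfl⟩ | ⟨rfl, rfl⟩⟩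
    · obtain ⟨h2, h3⟩ := hs u v h1
      refine ⟨by simp [absorb, h2], ?_⟩
      by_cases h4 : comp v = comp y
      · simpa [h2, h4] using h3
      · simpa [h2, h4] using h3
    · refine ⟨by simp [absorb, hxy], ?_⟩
      cases h5 : side u <;> cases h6 : side v <;> simp [hxy, h5, h6]
    · refine ⟨by simp [absorb, hxy], ?_⟩
      cases h5 : side u <;> cases h6 : side v <;> simp [hxy, h5, h6]
  count := by
    have hc := h.count
    have hsub : (Finset.univ.image comp).erase (comp y) ⊆
        Finset.univ.image (absorb comp (comp x) (comp y)) := by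
      intro a ha
      obtain ⟨ha1, ha2⟩ := Finset.mem_erase.1 ha
      obtain ⟨z, -, rfl⟩ := Finset.mem_image.1 ha2
      exact Finset.mem_image.2 ⟨z, Finset.mem_univ z, by simp [absorb, ha1]⟩
    have h1 := Finset.card_le_card hsub
    rw [Finset.card_erase_of_mem (Finset.mem_image_of_mem comp (Finset.mem_univ y))] at h1
    rw [uncoloured_join]
    omega

theorem persists_join (p : Position n k) (comp : Fin n → Fin n) (x y : Fin n) {a : Fin n}
    (ha : a ≠ comp y) :
    Persists p comp (p.join x y) (absorb comp (comp x) (comp y)) a where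
  graph := le_sup_left
  colour := fun _ _ h => h
  label := fun v hv => ⟨by simp [absorb, hv, ha], rfl⟩

/-- Builder always has a move that leaves at least as many components as there are uncoloured
vertices intact: there is one further component, which may be absorbed. -/
theorem exists_waiting_move (h : Layout p comp 1) {S : Finset (Fin n)}
    (hS : S.card ≤ p.uncoloured.card) {x : Fin n} (hx : p.colour x = none) (hxS : comp x ∈ S) :
    ∃ q comp', p.BuilderMove q ∧ Layout q comp' 0 ∧ q.uncoloured = p.uncoloured ∧
      ∀ a ∈ S, Persists p comp q comp' a := by
  have hlt : S.card < (Finset.univ.image comp).card := by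
    have := h.count
    omega
  obtain ⟨b, hb, hbS⟩ := Finset.exists_mem_notMem_of_card_lt_card hlt
  obtain ⟨y, -, rfl⟩ := Finset.mem_image.1 hb
  have hxy : comp x ≠ comp y := fun e => hbS (e ▸ hxS)
  exact ⟨_, _, h.builderMove hx hxy, h.join hx hxy, rfl,
    fun a ha => persists_join p comp x y fun e => hbS (e ▸ ha)⟩

end Layout

/-- To force a win it suffices to answer every Painter move. -/
theorem builderForces_of_paint {p : Position n k} {comp : Fin n → Fin n} (hp : Layout p comp 0)
    (hn : ¬ p.AllColoured)
    (h : ∀ v c, p.colour v = none → (p.paint v c).IsProper →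
      Layout (p.paint v c) comp 1 → ∃ r, (p.paint v c).BuilderMove r ∧ BuilderForces r) :
    BuilderForces p := by
  have h' : ∀ q, p.PainterMove q → ∃ r, q.BuilderMove r ∧ BuilderForces r := by
    rintro q ⟨v, c, hv, rfl, hq⟩
    exact h v c hv hq (hp.paint hv hq)
  choose! f hf using h'
  exact .intro p hp.isBipartite hn f (fun q hq => (hf q hq).1) fun q hq => (hf q hq).2

theorem HasVertex.not_allColoured {p : Position n k} {comp : Fin n → Fin n} {j : ℕ}
    {I : Finset (Fin k)} {a : Fin n} (h : HasVertex p comp j I a) : ¬ p.AllColoured := by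
  obtain ⟨w, -, hw, -⟩ := h
  exact Position.not_allColoured hw

theorem HasPair.not_allColoured {p : Position n k} {comp : Fin n → Fin n} {j i : ℕ}
    {I : Finset (Fin k)} {a : Fin n} (h : HasPair p comp j i I a) : ¬ p.AllColoured := by
  obtain ⟨u, v, A, h⟩ := h
  exact Position.not_allColoured h.left

/-! ### Builder's strategy -/

/-- Once an uncoloured vertex sees all colours, Builder wins by waiting. -/
theorem builderForces_of_hasVertex_all {j : ℕ} (hj : k ≤ j) {I : Finset (Fin k)} {a : Fin n}
    (m : ℕ) : ∀ (p : Position n k) (comp : Fin n → Fin n), p.uncoloured.card ≤ m →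
      Layout p comp 0 → HasVertex p comp j I a → BuilderForces p := by
  induction m with
  | zero =>
    rintro p comp hm - ⟨w, -, hw, -⟩
    have : w ∈ p.uncoloured := mem_uncoloured.2 hw
    have := Finset.card_pos.2 ⟨w, this⟩
    omega
  | succ m ih =>
    intro p comp hm hp ha
    refine builderForces_of_paint hp ha.not_allColoured fun v c hv hq hl => ?_
    obtain ⟨w, hw, hwn, hj', hI⟩ := ha
    have hall : p.seen w = Finset.univ := by
      rw [← Finset.card_eq_iff_eq_univ, Fintype.card_fin]
      have := Finset.card_le_univ (p.seen w)
      rw [Fintype.card_fin] at this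
      omega
    have hne : w ≠ v := by
      rintro rfl
      exact notMem_seen_of_isProper_paint hq (hall ▸ Finset.mem_univ c)
    have hs := seen_mono (q := p.paint v c) (le_refl p.graph) (paint_colour_of_some hv) w
    have hwn' : (p.paint v c).colour w = none := by rw [paint_colour_of_ne p c hne, hwn]
    have hcard := card_uncoloured_paint c hv
    obtain ⟨r, comp', hr, hl', hu, hP⟩ := hl.exists_waiting_move (S := {comp w})
      (by rw [Finset.card_singleton]; exact Finset.card_pos.2 ⟨w, mem_uncoloured.2 hwn'⟩)
      hwn' (Finset.mem_singleton_self _)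
    refine ⟨r, hr, ih r comp' (by rw [hu]; omega) hl' ((hP a (by simp [hw])).hasVertex ?_)⟩
    exact ⟨w, hw, hwn', hj'.trans (Finset.card_le_card hs), hI.trans hs⟩

/-- The weight `2 |Y| + |Z|` of a set `Y` of pairs and a set `Z` of single vertices that see one more
colour drops by at most one in a Painter move: a pair touched by Painter leaves such a vertex. -/
theorem exists_pairs_paint {p : Position n k} {comp : Fin n → Fin n} {j i : ℕ}
    {I : Finset (Fin k)} {Y Z : Finset (Fin n)} (hYZ : Disjoint Y Z)
    (hY : ∀ a ∈ Y, HasPair p comp j i I a) (hZ : ∀ a ∈ Z, HasVertex p comp (j + 1) I a)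
    {v : Fin n} {c : Fin k} (hv : p.colour v = none) (hp : (p.paint v c).IsProper) :
    ∃ Y' Z' : Finset (Fin n), Disjoint Y' Z' ∧ Y' ∪ Z' ⊆ Y ∪ Z ∧
      2 * Y.card + Z.card ≤ 2 * Y'.card + Z'.card + 1 ∧
      (∀ a ∈ Y', HasPair (p.paint v c) comp j i I a) ∧
      ∀ a ∈ Z', HasVertex (p.paint v c) comp (j + 1) I a := by
  have hY' : ∀ a ∈ Y, comp v ≠ a → HasPair (p.paint v c) comp j i I a :=
    fun a ha hne => (persists_paint hv hne).hasPair (hY a ha)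
  have hZ' : ∀ a ∈ Z, comp v ≠ a → HasVertex (p.paint v c) comp (j + 1) I a :=
    fun a ha hne => (persists_paint hv hne).hasVertex (hZ a ha)
  by_cases h1 : comp v ∈ Y
  · have h2 : comp v ∉ Z := Finset.disjoint_left.1 hYZ h1
    have hZ'' : ∀ a ∈ Z, HasVertex (p.paint v c) comp (j + 1) I a :=
      fun a ha => hZ' a ha fun e => h2 (e ▸ ha)
    rcases (hY _ h1).paint hv hp with h3 | ⟨h3, -⟩
    · refine ⟨Y, Z, hYZ, le_rfl, by omega, fun a ha => ?_, hZ''⟩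
      by_cases e : comp v = a
      · exact e ▸ h3
      · exact hY' a ha e
    · refine ⟨Y.erase (comp v), insert (comp v) Z, ?_, ?_, ?_, ?_, ?_⟩
      · rw [Finset.disjoint_left] at hYZ ⊢
        grind
      · grind
      · have := Finset.card_erase_add_one h1
        rw [Finset.card_insert_of_notMem h2]
        omega
      · intro a ha
        exact hY' a (Finset.mem_of_mem_erase ha) (Finset.ne_of_mem_erase ha).symm
      · intro a ha
        rcases Finset.mem_insert.1 ha with rfl | ha
        · exact h3
        · exact hZ'' a ha
  · refine ⟨Y, Z.erase (comp v), ?_, ?_, ?_, ?_, ?_⟩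
    · exact hYZ.mono_right (Finset.erase_subset _ _)
    · exact Finset.union_subset_union_right (Finset.erase_subset _ _)
    · have := Finset.pred_card_le_card_erase (s := Z) (a := comp v)
      omega
    · exact fun a ha => hY' a ha fun e => h1 (e ▸ ha)
    · exact fun a ha => hZ' a (Finset.mem_of_mem_erase ha) (Finset.ne_of_mem_erase ha).symm

/-- Two uncoloured vertices in different components that see the same colours become a pair when
Builder joins them. -/
theorem hasPair_join {p : Position n k} {comp : Fin n → Fin n} {j : ℕ} {I : Finset (Fin k)}
    {x y : Fin n} (hx : p.colour x = none) (hy : p.colour y = none) (hxy : comp x ≠ comp y)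
    (hj : j ≤ (p.seen x).card) (hI : I ⊆ p.seen x) (hs : p.seen x = p.seen y) :
    HasPair (p.join x y) (absorb comp (comp x) (comp y)) j j I (comp x) := by
  have hm : ∀ w, p.seen w ⊆ (p.join x y).seen w := seen_mono le_sup_left fun _ _ h => h
  have hne : x ≠ y := fun e => hxy (congrArg comp e)
  exact ⟨x, y, p.seen x, by simp [absorb, hxy], by simp [absorb], hx, hy,
    join_adj.2 (Or.inr ⟨hne, Or.inl ⟨rfl, rfl⟩⟩), hj, hI, hm x, hs ▸ hm y,
    hj.trans (Finset.card_le_card (hm x))⟩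

/-- If Builder joins a pair to a vertex whose colour is outside the common set `A` of the pair, then
an end of the pair sees at least one more colour. -/
theorem IsPair.join {p : Position n k} {comp : Fin n → Fin n} {j i : ℕ} {I A : Finset (Fin k)}
    {a u v y : Fin n} (H : IsPair p comp j i I a u v A) {c : Fin k} (hy : p.colour y = some c)
    (hc : c ∉ A) (hay : a ≠ comp y) :
    HasPair (p.join u y) (absorb comp (comp u) (comp y)) j (j + 1) I a := by
  have H' := (Layout.persists_join p comp u y hay).isPair H
  refine ⟨u, v, A, H'.label_left, H'.label_right, H'.left, H'.right, H'.adj, H'.card, H'.base,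
    H'.seen_left, H'.seen_right, ?_⟩
  have hne : u ≠ y := by
    rintro rfl
    exact hay H.label_left.symm
  have hcs : c ∈ (p.join u y).seen u :=
    mem_seen.2 ⟨y, join_adj.2 (Or.inr ⟨hne, Or.inl ⟨rfl, rfl⟩⟩), hy⟩
  have h2 := Finset.card_le_card (Finset.insert_subset hcs H'.seen_left)
  rw [Finset.card_insert_of_notMem hc] at h2
  have := H.card
  omega

/-- `BuilderForcesFrom k n j I N` says that Builder forces a win as soon as `N` components each have
an uncoloured vertex that sees at least `j` colours, among them those of `I`. -/
def BuilderForcesFrom (n : ℕ) {k : ℕ} (j : ℕ) (I : Finset (Fin k)) (N : ℕ) : Prop :=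
  ∀ (p : Position n k) (comp : Fin n → Fin n) (W : Finset (Fin n)), Layout p comp 0 →
    (∀ a ∈ W, HasVertex p comp j I a) → N ≤ W.card → BuilderForces p

/-- Builder joins pairs (labels in `X`) to vertices with a colour outside `I` (labels in `T`), one in
each of `r` rounds, and obtains pairs (labels in `Y`) and single vertices (labels in `Z`) that see
one more colour. If this stops because the colour at hand is seen by all pairs that are left, then
`I` can be enlarged by this colour. -/
theorem builderForces_of_supply {M j : ℕ} {I : Finset (Fin k)} (hM : 0 < M)
    (hadv : BuilderForcesFrom n (j + 1) I M)
    (hbase : ∀ c ∉ I, BuilderForcesFrom n j (insert c I) M) (r : ℕ) :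
    ∀ (p : Position n k) (comp : Fin n → Fin n) (X T Y Z : Finset (Fin n)), Layout p comp 0 →
      Disjoint X T → Disjoint (X ∪ T) (Y ∪ Z) → Disjoint Y Z →
      (∀ a ∈ X, HasPair p comp j j I a) → (∀ a ∈ T, HasSupply p comp I a) →
      (∀ a ∈ Y, HasPair p comp j (j + 1) I a) → (∀ a ∈ Z, HasVertex p comp (j + 1) I a) →
      2 * r + M ≤ X.card → r ≤ T.card → 2 * M ≤ 2 * Y.card + Z.card + r → BuilderForces p := by
  induction r with
  | zero =>
    rintro p comp X T Y Z hp - - hYZ - - hY hZ - - hcard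
    refine hadv p comp (Y ∪ Z) hp (fun a ha => ?_) ?_
    · rcases Finset.mem_union.1 ha with ha | ha
      · obtain ⟨u, v, A, H⟩ := hY a ha
        exact H.hasVertex
      · exact hZ a ha
    · rw [Finset.card_union_of_disjoint hYZ]
      omega
  | succ r ih =>
    intro p comp X T Y Z hp hXT hXTYZ hYZ hX hT hY hZ hXc hTc hcard
    obtain ⟨a₀, ha₀⟩ : X.Nonempty := Finset.card_pos.1 (by omega)
    refine builderForces_of_paint hp (hX a₀ ha₀).not_allColoured fun v c hv hq hl => ?_
    obtain ⟨Y', Z', hYZ', hsub, hcard', hY', hZ'⟩ := exists_pairs_paint hYZ hY hZ hv hq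
    have hX' : ∀ a ∈ X.erase (comp v), HasPair (p.paint v c) comp j j I a := fun a ha =>
      (persists_paint hv (Finset.ne_of_mem_erase ha).symm).hasPair
        (hX a (Finset.mem_of_mem_erase ha))
    have hXc' := Finset.pred_card_le_card_erase (s := X) (a := comp v)
    obtain ⟨t, ht⟩ : T.Nonempty := Finset.card_pos.1 (by omega)
    obtain ⟨y, d, rfl, hy, hdI⟩ := hasSupply_paint (c := c) hv (hT t ht)
    have hXne : ∀ a ∈ X, a ≠ comp y := fun a ha e => Finset.disjoint_left.1 hXT ha (e ▸ ht)
    have hYZne : ∀ a ∈ Y' ∪ Z', a ≠ comp y := fun a ha e =>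
      Finset.disjoint_left.1 hXTYZ (Finset.mem_union_right _ ht) (e ▸ hsub ha)
    by_cases h : ∃ a ∈ X.erase (comp v), ∃ u w A, IsPair (p.paint v c) comp j j I a u w A ∧ d ∉ A
    · obtain ⟨a, ha, u, w, A, H, hdA⟩ := h
      have haX := Finset.mem_of_mem_erase ha
      have hne : comp u ≠ comp y := H.label_left ▸ hXne a haX
      have haYZ : a ∉ Y' ∪ Z' := fun h =>
        Finset.disjoint_left.1 hXTYZ (Finset.mem_union_left _ haX) (hsub h)
      refine ⟨_, hl.builderMove H.left hne, ih _ _ ((X.erase (comp v)).erase a) (T.erase (comp y))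
        (insert a Y') Z' (hl.join H.left hne) ?_ ?_ ?_ ?_ ?_ ?_ ?_ ?_ ?_ ?_⟩
      · exact hXT.mono ((Finset.erase_subset _ _).trans (Finset.erase_subset _ _))
          (Finset.erase_subset _ _)
      · clear * - hXTYZ hsub hXT haX
        rw [Finset.disjoint_left] at hXTYZ hXT ⊢
        intro z
        have h1 := @hXTYZ z
        have h2 := @hsub z
        have h3 := @hXT z
        simp only [Finset.mem_union, Finset.mem_erase, Finset.mem_insert] at h1 h2 ⊢
        grind
      · exact Finset.disjoint_insert_left.2
          ⟨fun h => haYZ (Finset.mem_union_right _ h), hYZ'⟩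
      · exact fun b hb => (Layout.persists_join _ _ _ _ (hXne b
          (Finset.mem_of_mem_erase (Finset.mem_of_mem_erase hb)))).hasPair
          (hX' b (Finset.mem_of_mem_erase hb))
      · exact fun b hb => (Layout.persists_join _ _ _ _ (Finset.ne_of_mem_erase hb)).hasSupply
          (hasSupply_paint hv (hT b (Finset.mem_of_mem_erase hb)))
      · intro b hb
        rcases Finset.mem_insert.1 hb with rfl | hb
        · exact H.join hy hdA (hXne b haX)
        · exact (Layout.persists_join _ _ _ _ (hYZne b (Finset.mem_union_left _ hb))).hasPair
            (hY' b hb)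
      · exact fun b hb => (Layout.persists_join _ _ _ _
          (hYZne b (Finset.mem_union_right _ hb))).hasVertex (hZ' b hb)
      · rw [Finset.card_erase_of_mem ha]
        omega
      · rw [Finset.card_erase_of_mem ht]
        omega
      · rw [Finset.card_insert_of_notMem fun h => haYZ (Finset.mem_union_left _ h)]
        omega
    · push Not at h
      obtain ⟨a, ha⟩ : (X.erase (comp v)).Nonempty := Finset.card_pos.1 (by omega)
      obtain ⟨u, w, A, H⟩ := hX' a ha
      have hne : comp u ≠ comp y := H.label_left ▸ hXne a (Finset.mem_of_mem_erase ha)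
      refine ⟨_, hl.builderMove H.left hne, hbase d hdI _ _ (X.erase (comp v))
        (hl.join H.left hne) (fun b hb => ?_) (by omega)⟩
      refine (Layout.persists_join _ _ _ _ (hXne b (Finset.mem_of_mem_erase hb))).hasVertex ?_
      obtain ⟨u', w', A', H'⟩ := hX' b hb
      exact ⟨u', H'.label_left, H'.left, H'.card_left,
        Finset.insert_subset (H'.seen_left (h b hb u' w' A' H')) (H'.base.trans H'.seen_left)⟩

/-- There are two uncoloured vertices to every pair. -/
theorem two_mul_card_le_card_uncoloured {p : Position n k} {comp : Fin n → Fin n} {j i : ℕ}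
    {I : Finset (Fin k)} {X : Finset (Fin n)} (hX : ∀ a ∈ X, HasPair p comp j i I a) :
    2 * X.card ≤ p.uncoloured.card := by
  classical
  calc 2 * X.card = ∑ _a ∈ X, 2 := by rw [Finset.sum_const, smul_eq_mul, mul_comm]
    _ ≤ ∑ a ∈ X, (p.uncoloured.filter fun z => comp z = a).card := by
        refine Finset.sum_le_sum fun a ha => ?_
        obtain ⟨u, v, A, H⟩ := hX a ha
        refine Finset.one_lt_card.2 ⟨u, ?_, v, ?_, H.adj.ne⟩
        · simp [mem_uncoloured, H.left, H.label_left]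
        · simp [mem_uncoloured, H.right, H.label_right]
    _ = (X.biUnion fun a => p.uncoloured.filter fun z => comp z = a).card := by
        rw [Finset.card_biUnion]
        intro a _ b _ hab
        rw [Function.onFun, Finset.disjoint_left]
        simp only [Finset.mem_filter]
        rintro z ⟨-, rfl⟩ ⟨-, h⟩
        exact hab h
    _ ≤ p.uncoloured.card := by
        refine Finset.card_le_card fun z hz => ?_
        obtain ⟨a, -, h⟩ := Finset.mem_biUnion.1 hz
        exact (Finset.mem_filter.1 h).1

/-- Builder waits until Painter has touched half of the pairs. Then the touched ones (labels in `T`)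
supply the colours that are needed to attack the others (labels in `X`). With two uncoloured vertices
to each pair, `X` and `T` together are small enough for a waiting move as long as `|T| ≤ |X|`. -/
theorem builderForces_of_pairs {M j : ℕ} {I : Finset (Fin k)} (hM : 0 < M)
    (hadv : BuilderForcesFrom n (j + 1) I M)
    (hbase : ∀ c ∉ I, BuilderForcesFrom n j (insert c I) M) (m : ℕ) :
    ∀ (p : Position n k) (comp : Fin n → Fin n) (X T : Finset (Fin n)), p.uncoloured.card ≤ m →
      Layout p comp 0 → Disjoint X T → (∀ a ∈ X, HasPair p comp j j I a) →
      (∀ a ∈ T, HasSupply p comp I a) → T.card ≤ 5 * M → 10 * M ≤ X.card + T.card →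
      BuilderForces p := by
  induction m with
  | zero =>
    intro p comp X T hm hp hXT hX hT hTc hc
    have := two_mul_card_le_card_uncoloured hX
    omega
  | succ m ih =>
    intro p comp X T hm hp hXT hX hT hTc hc
    rcases hTc.eq_or_lt with hTc | hTc
    · exact builderForces_of_supply hM hadv hbase (2 * M) p comp X T ∅ ∅ hp hXT (by simp) (by simp)
        hX hT (by simp) (by simp) (by omega) (by omega) (by simp)
    obtain ⟨a₀, ha₀⟩ : X.Nonempty := Finset.card_pos.1 (by omega)
    refine builderForces_of_paint hp (hX a₀ ha₀).not_allColoured fun v c hv hq hl => ?_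
    have hcard := card_uncoloured_paint c hv
    obtain ⟨X', T', hXT', hX', hT', hTc', hc'⟩ : ∃ X' T' : Finset (Fin n), Disjoint X' T' ∧
        (∀ a ∈ X', HasPair (p.paint v c) comp j j I a) ∧
        (∀ a ∈ T', HasSupply (p.paint v c) comp I a) ∧ T'.card ≤ 5 * M ∧
        10 * M ≤ X'.card + T'.card := by
      have hT' : ∀ a ∈ T, HasSupply (p.paint v c) comp I a := fun a ha =>
        hasSupply_paint hv (hT a ha)
      have hX' : ∀ a ∈ X, comp v ≠ a → HasPair (p.paint v c) comp j j I a := fun a ha hne =>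
        (persists_paint hv hne).hasPair (hX a ha)
      by_cases h : ∀ a ∈ X, HasPair (p.paint v c) comp j j I a
      · exact ⟨X, T, hXT, h, hT', hTc.le, hc⟩
      · push Not at h
        obtain ⟨a, ha, hna⟩ := h
        have hva : comp v = a := by
          by_contra hne
          exact hna (hX' a ha hne)
        have hsup := (((hX a ha).paint hv hq).resolve_left hna).2
        have haT : a ∉ T := Finset.disjoint_left.1 hXT ha
        refine ⟨X.erase a, insert a T, ?_, ?_, ?_, ?_, ?_⟩
        · rw [Finset.disjoint_left] at hXT ⊢
          grind
        · exact fun b hb => hX' b (Finset.mem_of_mem_erase hb)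
            (hva ▸ (Finset.ne_of_mem_erase hb).symm)
        · intro b hb
          rcases Finset.mem_insert.1 hb with rfl | hb
          · exact hsup
          · exact hT' b hb
        · rw [Finset.card_insert_of_notMem haT]
          omega
        · have := Finset.card_erase_add_one ha
          rw [Finset.card_insert_of_notMem haT]
          omega
    obtain ⟨a, ha⟩ : X'.Nonempty := Finset.card_pos.1 (by omega)
    obtain ⟨u, w, A, H⟩ := hX' a ha
    have h2 := two_mul_card_le_card_uncoloured hX'
    obtain ⟨r, comp', hr, hl', hu, hP⟩ := hl.exists_waiting_move (S := X' ∪ T')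
      (by rw [Finset.card_union_of_disjoint hXT']; omega) H.left
      (Finset.mem_union_left _ (H.label_left ▸ ha))
    exact ⟨r, hr, ih r comp' X' T' (by rw [hu]; omega) hl' hXT'
      (fun b hb => (hP b (Finset.mem_union_left _ hb)).hasPair (hX' b hb))
      (fun b hb => (hP b (Finset.mem_union_right _ hb)).hasSupply (hT' b hb)) hTc' hc'⟩

/-- For `r` rounds Builder forms pairs from vertices (labels in `W`) that see the same colours. At the
end at least `10 M` untouched pairs are left (labels in `X`), or Painter has touched so many pairs that
there are `M` vertices (labels in `Z`) that see one more colour. -/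
theorem builderForces_of_vertices {M j : ℕ} {I : Finset (Fin k)} (hM : 0 < M)
    (hadv : BuilderForcesFrom n (j + 1) I M)
    (hbase : ∀ c ∉ I, BuilderForcesFrom n j (insert c I) M) (r : ℕ) :
    ∀ (p : Position n k) (comp : Fin n → Fin n) (W X Z : Finset (Fin n)), Layout p comp 0 →
      Disjoint W (X ∪ Z) → Disjoint X Z → (∀ a ∈ W, HasVertex p comp j I a) →
      (∀ a ∈ X, HasPair p comp j j I a) → (∀ a ∈ Z, HasVertex p comp (j + 1) I a) →
      3 * r + 2 ^ k ≤ W.card → 21 * M ≤ 2 * X.card + Z.card + r → BuilderForces p := by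
  induction r with
  | zero =>
    rintro p comp W X Z hp - - - hX hZ - hcard
    by_cases hZc : M ≤ Z.card
    · exact hadv p comp Z hp hZ hZc
    · exact builderForces_of_pairs hM hadv hbase _ p comp X ∅ le_rfl hp (by simp) hX (by simp)
        (by simp) (by simp; omega)
  | succ r ih =>
    intro p comp W X Z hp hWXZ hXZ hW hX hZ hWc hcard
    have hpow := Nat.two_pow_pos k
    obtain ⟨a₀, ha₀⟩ : W.Nonempty := Finset.card_pos.1 (by omega)
    refine builderForces_of_paint hp (hW a₀ ha₀).not_allColoured fun v c hv hq hl => ?_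
    obtain ⟨X', Z', hXZ', hsub, hcard', hX', hZ'⟩ := exists_pairs_paint hXZ hX hZ hv hq
    have hW' : ∀ a ∈ W.erase (comp v), HasVertex (p.paint v c) comp j I a := fun a ha =>
      (persists_paint hv (Finset.ne_of_mem_erase ha).symm).hasVertex
        (hW a (Finset.mem_of_mem_erase ha))
    have hWc' := Finset.pred_card_le_card_erase (s := W) (a := comp v)
    choose! f hf using hW'
    have huniv : (Finset.univ : Finset (Finset (Fin k))).card < (W.erase (comp v)).card := by
      rw [Finset.card_univ, Fintype.card_finset, Fintype.card_fin]
      omega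
    obtain ⟨a, ha, b, hb, hab, hs⟩ := Finset.exists_ne_map_eq_of_card_lt_of_maps_to huniv
      (f := fun a => (p.paint v c).seen (f a)) (by simp [Set.MapsTo])
    obtain ⟨ha1, ha2, ha3, ha4⟩ := hf a ha
    obtain ⟨hb1, hb2, -, -⟩ := hf b hb
    have hne : comp (f a) ≠ comp (f b) := by rw [ha1, hb1]; exact hab
    have haW := Finset.mem_of_mem_erase ha
    have hbW := Finset.mem_of_mem_erase hb
    have hnot : ∀ z ∈ W, z ∉ X' ∪ Z' := fun z hz h => Finset.disjoint_left.1 hWXZ hz (hsub h)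
    have hXZne : ∀ z ∈ X' ∪ Z', z ≠ comp (f b) := fun z hz e =>
      hnot b hbW (hb1 ▸ e ▸ hz)
    refine ⟨_, hl.builderMove ha2 hne, ih _ _ (((W.erase (comp v)).erase a).erase b)
        (insert a X') Z' (hl.join ha2 hne) ?_ ?_ ?_ ?_ ?_ ?_ ?_⟩
    · clear * - hWXZ hsub
      rw [Finset.disjoint_left] at hWXZ ⊢
      intro z
      have h1 := @hWXZ z
      have h2 := @hsub z
      simp only [Finset.mem_union, Finset.mem_erase, Finset.mem_insert] at h1 h2 ⊢
      grind
    · exact Finset.disjoint_insert_left.2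
        ⟨fun h => hnot a haW (Finset.mem_union_right _ h), hXZ'⟩
    · exact fun z hz => (Layout.persists_join _ _ _ _
        (hb1.symm ▸ Finset.ne_of_mem_erase hz)).hasVertex ⟨f z, hf z
          (Finset.mem_of_mem_erase (Finset.mem_of_mem_erase hz))⟩
    · intro z hz
      rcases Finset.mem_insert.1 hz with rfl | hz
      · have := hasPair_join ha2 hb2 hne ha3 ha4 hs
        rwa [ha1] at this ⊢
      · exact (Layout.persists_join _ _ _ _ (hXZne z (Finset.mem_union_left _ hz))).hasPair
          (hX' z hz)
    · exact fun z hz => (Layout.persists_join _ _ _ _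
        (hXZne z (Finset.mem_union_right _ hz))).hasVertex (hZ' z hz)
    · rw [Finset.card_erase_of_mem (Finset.mem_erase.2 ⟨hab.symm, hb⟩), Finset.card_erase_of_mem ha]
      omega
    · rw [Finset.card_insert_of_notMem fun h => hnot a haW (Finset.mem_union_left _ h)]
      omega

/-- Builder wins from sufficiently many components with a vertex that sees `j` colours: each step
costs a constant factor and increases `j + |I|`, which is at most `2 k`. -/
theorem builderForcesFrom_of_le (m : ℕ) : ∀ (j : ℕ) (I : Finset (Fin k)), 2 * k ≤ j + I.card + m →
    BuilderForcesFrom n j I (2 ^ (6 * m + k)) := by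
  induction m with
  | zero =>
    intro j I h p comp W hp hW hc
    have hI := Finset.card_le_univ I
    rw [Fintype.card_fin] at hI
    obtain ⟨a, ha⟩ : W.Nonempty := Finset.card_pos.1 (lt_of_lt_of_le (by positivity) hc)
    exact builderForces_of_hasVertex_all (by omega) _ p comp le_rfl hp (hW a ha)
  | succ m ih =>
    intro j I h p comp W hp hW hc
    refine builderForces_of_vertices (M := 2 ^ (6 * m + k)) (j := j) (I := I) (by positivity)
      (ih (j + 1) I (by omega)) (fun c hcI => ih j (insert c I) ?_) (21 * 2 ^ (6 * m + k)) p comp W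
      ∅ ∅ hp (by simp) (by simp) hW (by simp) (by simp) ?_ (by simp)
    · rw [Finset.card_insert_of_notMem hcI]
      omega
    · refine le_trans ?_ hc
      -- With `M = 2 ^ (6 * m + k)`, `21 * M` rounds of pairing need
      -- `3 * (21 * M) + 2 ^ k ≤ 64 * M` vertices.
      have h1 : 2 ^ k ≤ 2 ^ (6 * m + k) := Nat.pow_le_pow_right (by norm_num) (by omega)
      have h2 : 2 ^ (6 * (m + 1) + k) = 64 * 2 ^ (6 * m + k) := by
        rw [show 6 * (m + 1) + k = 6 + (6 * m + k) by ring, pow_add]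
        norm_num
      omega

theorem layout_start : Layout (start n k) id 0 where
  proper := isProper_start
  sides := ⟨fun _ => false, fun u v h => absurd h (by simp [start])⟩
  count := by
    rw [Finset.image_id]
    exact Finset.card_le_univ (start n k).uncoloured

/-- With exponentially many vertices Builder forces a win. -/
theorem builderForces_start (h : 2 ^ (13 * k) ≤ n) : BuilderForces (start n k) := by
  refine builderForcesFrom_of_le (2 * k) 0 ∅ (by simp) (start n k) id Finset.univ layout_start
    (fun a _ => ⟨a, rfl, rfl, Nat.zero_le _, Finset.empty_subset _⟩) ?_
  rw [Finset.card_univ, Fintype.card_fin, show 6 * (2 * k) + k = 13 * k by ring]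
  exact h

/-! ### Painter's strategy -/

/-- The positions that Painter maintains; Builder is to move. The uncoloured vertices are
independent, and their danger is bounded by the exponential weight of the number of colours they
see. No vertex sees `k - 1` colours, so that no single edge is fatal, and no two vertices see the
same `k - 2` colours, so that no edge between two of them forces a vertex that sees `k - 1`. -/
structure Safe (p : Position n k) : Prop where
  proper : p.IsProper
  independent : ∀ u v, p.colour u = none → p.colour v = none → ¬ p.graph.Adj u v
  weight : ∑ v ∈ p.uncoloured, 2 ^ (p.seen v).card < 2 ^ k
  card_seen : ∀ v, p.colour v = none → (p.seen v).card + 2 ≤ k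
  distinct : ∀ u v, p.colour u = none → p.colour v = none → u ≠ v → (p.seen u).card + 2 = k →
    p.seen u ≠ p.seen v

theorem seen_paint_of_adj {p : Position n k} {x v : Fin n} {c : Fin k} (hx : p.colour x = none)
    (h : p.graph.Adj v x) : (p.paint x c).seen v = insert c (p.seen v) := by
  ext d
  rw [Finset.mem_insert, mem_seen, mem_seen]
  constructor
  · rintro ⟨w, hw, hd⟩
    by_cases hwx : w = x
    · subst hwx
      rw [paint_colour_self] at hd
      exact Or.inl (Option.some.inj hd).symm
    · rw [paint_colour_of_ne p c hwx] at hd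
      exact Or.inr ⟨w, hw, hd⟩
  · rintro (rfl | ⟨w, hw, hd⟩)
    · exact ⟨x, h, paint_colour_self p x d⟩
    · exact ⟨w, hw, paint_colour_of_some hx w d hd⟩

theorem seen_paint_of_not_adj {p : Position n k} {x v : Fin n} {c : Fin k}
    (h : ¬ p.graph.Adj v x) : (p.paint x c).seen v = p.seen v := by
  ext d
  rw [mem_seen, mem_seen]
  refine exists_congr fun w => and_congr_right fun hw => ?_
  have hwx : w ≠ x := by
    rintro rfl
    exact h hw
  rw [paint_colour_of_ne p c hwx]

theorem seen_join {p : Position n k} {x y v : Fin n} (h1 : v = x → p.colour y = none)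
    (h2 : v = y → p.colour x = none) : (p.join x y).seen v = p.seen v := by
  ext d
  rw [mem_seen, mem_seen]
  constructor
  · rintro ⟨w, hw, hd⟩
    change p.colour w = some d at hd
    rcases join_adj.1 hw with hw | ⟨-, ⟨rfl, rfl⟩ | ⟨rfl, rfl⟩⟩
    · exact ⟨w, hw, hd⟩
    · rw [h1 rfl] at hd
      cases hd
    · rw [h2 rfl] at hd
      cases hd
  · rintro ⟨w, hw, hd⟩
    exact ⟨w, join_adj.2 (Or.inl hw), hd⟩

namespace Safe

variable {p : Position n k}

/-- Painter may colour `x` with `c` in answer to a Builder move to `r` if this changes nothing for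
the other uncoloured vertices. -/
theorem exists_move_of_seen_eq (h : Safe p) {r : Position n k} (hr : r.IsProper)
    (hcol : r.colour = p.colour) {x : Fin n} (hx : p.colour x = none) {c : Fin k}
    (hc : c ∉ r.seen x)
    (hind : ∀ u v, p.colour u = none → p.colour v = none → u ≠ x → v ≠ x → ¬ r.graph.Adj u v)
    (hseen : ∀ v, p.colour v = none → v ≠ x → (r.paint x c).seen v = p.seen v) :
    ∃ q, r.PainterMove q ∧ Safe q := by
  have hnone : ∀ v, (r.paint x c).colour v = none → p.colour v = none ∧ v ≠ x := by
    intro v hv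
    by_cases e : v = x
    · subst e
      rw [paint_colour_self] at hv
      cases hv
    · rw [paint_colour_of_ne r c e, hcol] at hv
      exact ⟨hv, e⟩
  refine ⟨_, painterMove_paint hr (hcol ▸ hx) hc, isProper_paint hr hc, ?_, ?_, ?_, ?_⟩
  · intro u v hu hv
    exact hind u v (hnone u hu).1 (hnone v hv).1 (hnone u hu).2 (hnone v hv).2
  · refine lt_of_le_of_lt ?_ h.weight
    have hsub : (r.paint x c).uncoloured ⊆ p.uncoloured := fun v hv =>
      mem_uncoloured.2 (hnone v (mem_uncoloured.1 hv)).1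
    refine (Finset.sum_le_sum fun v hv => ?_).trans
      (Finset.sum_le_sum_of_subset hsub)
    obtain ⟨h1, h2⟩ := hnone v (mem_uncoloured.1 hv)
    rw [hseen v h1 h2]
  · intro v hv
    obtain ⟨h1, h2⟩ := hnone v hv
    rw [hseen v h1 h2]
    exact h.card_seen v h1
  · intro u v hu hv huv
    obtain ⟨h1, h2⟩ := hnone u hu
    obtain ⟨h3, h4⟩ := hnone v hv
    rw [hseen u h1 h2, hseen v h3 h4]
    exact h.distinct u v h1 h3 huv

theorem exists_notMem_of_card_lt {A : Finset (Fin k)} (h : A.card < k) : ∃ c, c ∉ A := by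
  by_contra! h'
  rw [Finset.eq_univ_iff_forall.2 h', Finset.card_univ, Fintype.card_fin] at h
  exact lt_irrefl _ h

/-- If Builder's move does not affect the uncoloured vertices, then Painter colours any of them. -/
theorem exists_move_of_unaffected (h : Safe p) {r : Position n k} (hr : r.IsProper)
    (hcol : r.colour = p.colour) (hind : ∀ u v, p.colour u = none → p.colour v = none →
      ¬ r.graph.Adj u v) (hseen : ∀ v, p.colour v = none → r.seen v = p.seen v) :
    r.AllColoured ∨ ∃ q, r.PainterMove q ∧ Safe q := by
  by_cases hall : r.AllColoured
  · exact Or.inl hall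
  right
  obtain ⟨x, hx⟩ := exists_uncoloured hall
  rw [hcol] at hx
  have hk := h.card_seen x hx
  obtain ⟨c, hc⟩ := exists_notMem_of_card_lt (A := r.seen x) (by rw [hseen x hx]; omega)
  refine h.exists_move_of_seen_eq hr hcol hx hc (fun u v hu hv _ _ => hind u v hu hv) ?_
  intro v hv _
  rw [seen_paint_of_not_adj (hind v x hv hx), hseen v hv]

/-- The answer to an edge between an uncoloured vertex `x` and a coloured one: colour `x`, which
sees at most `k - 1` colours. -/
theorem exists_move_of_join_coloured (h : Safe p) {x y : Fin n} (hx : p.colour x = none)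
    (hy : p.colour y ≠ none) : ∃ q, (p.join x y).PainterMove q ∧ Safe q := by
  obtain ⟨d, hd⟩ := Option.ne_none_iff_exists'.1 hy
  have hk := h.card_seen x hx
  have hsub : (p.join x y).seen x ⊆ insert d (p.seen x) := by
    intro c hc
    obtain ⟨w, hw, hwc⟩ := mem_seen.1 hc
    change p.colour w = some c at hwc
    rcases join_adj.1 hw with hw | ⟨-, ⟨-, rfl⟩ | ⟨-, rfl⟩⟩
    · exact Finset.mem_insert_of_mem (mem_seen.2 ⟨w, hw, hwc⟩)
    · rw [hd] at hwc
      cases hwc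
      exact Finset.mem_insert_self _ _
    · rw [hx] at hwc
      cases hwc
  obtain ⟨c, hc⟩ := exists_notMem_of_card_lt (A := (p.join x y).seen x) (by
    have := Finset.card_le_card hsub
    have := Finset.card_insert_le d (p.seen x)
    omega)
  have hind : ∀ u v, p.colour u = none → p.colour v = none → ¬ (p.join x y).graph.Adj u v := by
    intro u v hu hv hadj
    rcases join_adj.1 hadj with hadj | ⟨-, ⟨-, rfl⟩ | ⟨rfl, -⟩⟩
    · exact h.independent u v hu hv hadj
    · exact hy hv
    · exact hy hu
  refine h.exists_move_of_seen_eq (isProper_join h.proper hx) rfl hx hc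
    (fun u v hu hv _ _ => hind u v hu hv) fun v hv hvx => ?_
  rw [seen_paint_of_not_adj (hind v x hv hx),
    seen_join (fun e => absurd e hvx) fun e => absurd hv (e ▸ hy)]

theorem not_adj_join_of_ne (h : Safe p) {x y u v : Fin n} (hu : p.colour u = none)
    (hv : p.colour v = none) (hux : u ≠ x) (hvx : v ≠ x) : ¬ (p.join x y).graph.Adj u v := by
  intro hadj
  rcases join_adj.1 hadj with hadj | ⟨-, ⟨rfl, -⟩ | ⟨-, rfl⟩⟩
  · exact h.independent u v hu hv hadj
  · exact hux rfl
  · exact hvx rfl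

theorem not_adj_join (h : Safe p) {x y v : Fin n} (hx : p.colour x = none)
    (hv : p.colour v = none) (hvx : v ≠ x) (hvy : v ≠ y) : ¬ (p.join x y).graph.Adj v x := by
  intro hadj
  rcases join_adj.1 hadj with hadj | ⟨-, ⟨rfl, -⟩ | ⟨rfl, -⟩⟩
  · exact h.independent v x hv hx hadj
  · exact hvx rfl
  · exact hvy rfl

/-- The answer to an edge between two uncoloured vertices of which `y` sees a colour that `x` does
not see: colour `x` with it. -/
theorem exists_move_of_join_of_mem (h : Safe p) {x y : Fin n} (hxy : x ≠ y)
    (hx : p.colour x = none) (hy : p.colour y = none) {c : Fin k} (hcx : c ∉ p.seen x)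
    (hcy : c ∈ p.seen y) : ∃ q, (p.join x y).PainterMove q ∧ Safe q := by
  have hs : ∀ v, (p.join x y).seen v = p.seen v := fun v => seen_join (fun _ => hy) fun _ => hx
  refine h.exists_move_of_seen_eq (isProper_join h.proper hx) rfl hx (c := c)
    (by rwa [hs x]) (fun u v hu hv hux hvx => h.not_adj_join_of_ne hu hv hux hvx)
    fun v hv hvx => ?_
  by_cases e : v = y
  · subst e
    rw [seen_paint_of_adj (p := p.join x v) hx (join_adj.2 (Or.inr ⟨hvx, Or.inr ⟨rfl, rfl⟩⟩)),
      hs v, Finset.insert_eq_of_mem hcy]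
  · rw [seen_paint_of_not_adj (h.not_adj_join hx hv hvx e), hs v]

/-- If two uncoloured vertices see the same set `A` of colours, then there is a colour that can be
added to `A` without making another vertex see the same `k - 2` colours: otherwise `|A| = k - 3`, and
three vertices of weight `2 ^ (k - 2)` and two of weight `2 ^ (k - 3)` would add up to `2 ^ k`. -/
theorem exists_colour (h : Safe p) {x y : Fin n} (hxy : x ≠ y) (hx : p.colour x = none)
    (hy : p.colour y = none) (hs : p.seen x = p.seen y) (hk : (p.seen x).card + 3 ≤ k) :
    ∃ c, c ∉ p.seen x ∧ ∀ v, p.colour v = none → (p.seen x).card + 3 = k →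
      p.seen v ≠ insert c (p.seen x) := by
  by_contra! H
  obtain ⟨c₀, hc₀⟩ := exists_notMem_of_card_lt (A := p.seen x) (by omega)
  obtain ⟨-, -, hcard, -⟩ := H c₀ hc₀
  have H' : ∀ c, c ∉ p.seen x → ∃ v, p.colour v = none ∧ p.seen v = insert c (p.seen x) := by
    intro c hc
    obtain ⟨v, h1, -, h2⟩ := H c hc
    exact ⟨v, h1, h2⟩
  have : Nonempty (Fin n) := ⟨x⟩
  choose! f hf1 hf2 using H'
  have hinj : Set.InjOn f (↑((p.seen x)ᶜ) : Set (Fin k)) := by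
    intro c hc d hd hcd
    have hc' := Finset.mem_compl.1 (Finset.mem_coe.1 hc)
    have hd' := Finset.mem_compl.1 (Finset.mem_coe.1 hd)
    have h1 : c ∈ insert d (p.seen x) := by
      rw [← hf2 d hd', ← hcd, hf2 c hc']
      exact Finset.mem_insert_self _ _
    exact (Finset.mem_insert.1 h1).resolve_right hc'
  have hdisj : Disjoint ((p.seen x)ᶜ.image f) {x, y} := by
    rw [Finset.disjoint_left]
    intro v hv hv'
    obtain ⟨c, hc, rfl⟩ := Finset.mem_image.1 hv
    have hc' := Finset.mem_compl.1 hc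
    have h1 : c ∈ p.seen (f c) := by
      rw [hf2 c hc']
      exact Finset.mem_insert_self _ _
    rcases Finset.mem_insert.1 hv' with e | e
    · exact hc' (e ▸ h1)
    · rw [Finset.mem_singleton.1 e, ← hs] at h1
      exact hc' h1
  have hsub : (p.seen x)ᶜ.image f ∪ {x, y} ⊆ p.uncoloured := by
    intro v hv
    rw [mem_uncoloured]
    rcases Finset.mem_union.1 hv with hv | hv
    · obtain ⟨c, hc, rfl⟩ := Finset.mem_image.1 hv
      exact hf1 c (Finset.mem_compl.1 hc)
    · rcases Finset.mem_insert.1 hv with rfl | hv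
      · exact hx
      · exact Finset.mem_singleton.1 hv ▸ hy
  have hsum := (Finset.sum_le_sum_of_subset (f := fun v => 2 ^ (p.seen v).card) hsub).trans_lt
    h.weight
  have hcompl : (p.seen x)ᶜ.card = 3 := by
    rw [Finset.card_compl, Fintype.card_fin]
    omega
  rw [Finset.sum_union hdisj, Finset.sum_image hinj, Finset.sum_pair hxy, ← hs,
    Finset.sum_congr rfl (g := fun _ => 2 ^ ((p.seen x).card + 1)) fun c hc => by
      rw [hf2 c (Finset.mem_compl.1 hc), Finset.card_insert_of_notMem (Finset.mem_compl.1 hc)],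
    Finset.sum_const, hcompl, pow_add, smul_eq_mul] at hsum
  have hpow : 2 ^ k = 2 ^ (p.seen x).card * 2 ^ 3 := by
    rw [← pow_add]
    exact congrArg _ hcard.symm
  omega

/-- The answer to an edge between two uncoloured vertices that see the same colours: colour one of
them, which doubles the weight of the other one. -/
theorem exists_move_of_join_of_seen_eq (h : Safe p) {x y : Fin n} (hxy : x ≠ y)
    (hx : p.colour x = none) (hy : p.colour y = none) (hs : p.seen x = p.seen y) :
    ∃ q, (p.join x y).PainterMove q ∧ Safe q := by
  have hk : (p.seen x).card + 3 ≤ k := by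
    have h1 := h.card_seen x hx
    have h2 : (p.seen x).card + 2 ≠ k := fun e => h.distinct x y hx hy hxy e hs
    omega
  obtain ⟨c, hc, hc'⟩ := h.exists_colour hxy hx hy hs hk
  have hs' : ∀ v, (p.join x y).seen v = p.seen v := fun v => seen_join (fun _ => hy) fun _ => hx
  have hseeny : ((p.join x y).paint x c).seen y = insert c (p.seen x) := by
    rw [seen_paint_of_adj (p := p.join x y) hx
      (join_adj.2 (Or.inr ⟨hxy.symm, Or.inr ⟨rfl, rfl⟩⟩)), hs' y, hs]
  have hseen : ∀ v, p.colour v = none → v ≠ x → v ≠ y →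
      ((p.join x y).paint x c).seen v = p.seen v := fun v hv hvx hvy => by
    rw [seen_paint_of_not_adj (h.not_adj_join hx hv hvx hvy), hs' v]
  have hunc : ((p.join x y).paint x c).uncoloured = p.uncoloured.erase x := by
    rw [uncoloured_paint, uncoloured_join]
  have hnone : ∀ v, ((p.join x y).paint x c).colour v = none → p.colour v = none ∧ v ≠ x := by
    intro v hv
    have := mem_uncoloured.2 hv
    rw [hunc, Finset.mem_erase, mem_uncoloured] at this
    exact this.symm
  have hcx : c ∉ (p.join x y).seen x := by rwa [hs' x]
  have hproper := isProper_join (y := y) h.proper hx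
  have hcard : (insert c (p.seen x)).card = (p.seen x).card + 1 := Finset.card_insert_of_notMem hc
  refine ⟨_, painterMove_paint hproper hx hcx, isProper_paint hproper hcx, ?_, ?_, ?_, ?_⟩
  · intro u v hu hv
    exact h.not_adj_join_of_ne (hnone u hu).1 (hnone v hv).1 (hnone u hu).2 (hnone v hv).2
  · have hyx : y ∈ p.uncoloured.erase x :=
      Finset.mem_erase.2 ⟨hxy.symm, mem_uncoloured.2 hy⟩
    have hw := h.weight
    rw [← Finset.add_sum_erase _ _ (mem_uncoloured.2 hx), ← Finset.add_sum_erase _ _ hyx] at hw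
    rw [hunc, ← Finset.add_sum_erase _ _ hyx, hseeny, hcard, Finset.sum_congr rfl
      (g := fun v => 2 ^ (p.seen v).card)]
    · rw [← hs] at hw
      rw [pow_succ]
      omega
    · intro v hv
      rw [Finset.mem_erase, Finset.mem_erase, mem_uncoloured] at hv
      rw [hseen v hv.2.2 hv.2.1 hv.1]
  · intro v hv
    obtain ⟨h1, h2⟩ := hnone v hv
    by_cases e : v = y
    · subst e
      rw [hseeny, hcard]
      omega
    · rw [hseen v h1 h2 e]
      exact h.card_seen v h1
  · intro u v hu hv huv
    obtain ⟨h1, h2⟩ := hnone u hu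
    obtain ⟨h3, h4⟩ := hnone v hv
    by_cases eu : u = y
    · subst eu
      rw [hseeny, hcard, hseen v h3 h4 huv.symm]
      intro e
      exact (hc' v h3 (by omega)).symm
    · by_cases ev : v = y
      · subst ev
        rw [hseen u h1 h2 eu, hseeny]
        intro e e'
        refine hc' u h1 ?_ e'
        rw [e', hcard] at e
        omega
      · rw [hseen u h1 h2 eu, hseen v h3 h4 ev]
        exact h.distinct u v h1 h3 huv

/-- Painter can answer every move of Builder, and also a pass, in such a way that the position is
safe again. -/
theorem exists_move (h : Safe p) {r : Position n k} (hr : r = p ∨ p.BuilderMove r) :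
    r.AllColoured ∨ ∃ q, r.PainterMove q ∧ Safe q := by
  rcases hr with rfl | ⟨x, y, hxy, -, rfl, hproper⟩
  · exact h.exists_move_of_unaffected h.proper rfl h.independent fun _ _ => rfl
  change (p.join x y).AllColoured ∨ ∃ q, (p.join x y).PainterMove q ∧ Safe q
  have hcomm : p.join x y = p.join y x := by rw [join, join, SimpleGraph.edge_comm]
  by_cases hx : p.colour x = none <;> by_cases hy : p.colour y = none
  · right
    by_cases hs : p.seen x = p.seen y
    · exact h.exists_move_of_join_of_seen_eq hxy hx hy hs
    · by_cases hsub : p.seen y ⊆ p.seen x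
      · obtain ⟨c, hcx, hcy⟩ := Finset.exists_of_ssubset (hsub.ssubset_of_ne (Ne.symm hs))
        rw [hcomm]
        exact h.exists_move_of_join_of_mem hxy.symm hy hx hcy hcx
      · obtain ⟨c, hcy, hcx⟩ := Finset.not_subset.1 hsub
        exact h.exists_move_of_join_of_mem hxy hx hy hcx hcy
  · exact Or.inr (h.exists_move_of_join_coloured hx hy)
  · rw [hcomm]
    exact Or.inr (h.exists_move_of_join_coloured hy hx)
  · refine h.exists_move_of_unaffected hproper rfl (fun u v hu hv hadj => ?_) fun v hv =>
      seen_join (p := p) (fun e => absurd hv (e ▸ hx)) fun e => absurd hv (e ▸ hy)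
    rcases join_adj.1 hadj with hadj | ⟨-, ⟨rfl, -⟩ | ⟨rfl, -⟩⟩
    · exact h.independent u v hu hv hadj
    · exact hx hu
    · exact hy hu

end Safe

theorem safe_start (hk : 3 ≤ k) (hn : n < 2 ^ k) : Safe (start n k) := by
  have hseen : ∀ v, (start n k).seen v = ∅ := by
    intro v
    ext c
    simp [mem_seen, start]
  refine ⟨isProper_start, fun u v _ _ h => absurd h (by simp [start]), ?_, ?_, ?_⟩
  · simp only [hseen, Finset.card_empty, pow_zero, Finset.sum_const, smul_eq_mul, mul_one]
    refine lt_of_le_of_lt (Finset.card_le_univ _) ?_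
    rwa [Fintype.card_fin]
  · intro v _
    rw [hseen, Finset.card_empty]
    omega
  · intro u v _ _ _ h
    rw [hseen, Finset.card_empty] at h
    omega

/-! ### Plays -/

section Play

variable (σ : PainterStrategy n k) (τ : BuilderStrategy n k)

theorem position_succ_of_ended {i : ℕ} (h : (position σ τ i).Ended) :
    position σ τ (i + 1) = position σ τ i :=
  if_pos h

theorem position_of_ended {i j : ℕ} (h : (position σ τ i).Ended) (hij : i ≤ j) :
    position σ τ j = position σ τ i := by
  induction j, hij using Nat.le_induction with
  | base => rfl
  | succ j _ ih => rw [position_succ_of_ended σ τ (ih ▸ h), ih]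

theorem position_succ_of_even {i : ℕ} (hi : Even i) (h : ¬ (position σ τ i).Ended) :
    position σ τ (i + 1) = σ.move (run σ τ i).1 (position σ τ i) :=
  (if_neg h).trans (if_pos hi)

theorem painterMove_position {i : ℕ} (hi : Even i) (h : ¬ (position σ τ i).Ended) :
    (position σ τ i).PainterMove (position σ τ (i + 1)) := by
  rw [position_succ_of_even σ τ hi h]
  exact σ.legal _ _ (not_not.1 fun h' => h (Or.inr h'))

theorem position_succ_of_not_even {i : ℕ} (hi : ¬ Even i) (h : ¬ (position σ τ i).Ended)
    (h' : ∃ q, (position σ τ i).BuilderMove q) :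
    position σ τ (i + 1) = τ.move (run σ τ i).1 (position σ τ i) :=
  (if_neg h).trans ((if_neg hi).trans (if_pos h'))

theorem position_succ_eq_or_builderMove {i : ℕ} (hi : ¬ Even i) :
    position σ τ (i + 1) = position σ τ i ∨
      (position σ τ i).BuilderMove (position σ τ (i + 1)) := by
  by_cases h : (position σ τ i).Ended
  · exact Or.inl (position_succ_of_ended σ τ h)
  by_cases h' : ∃ q, (position σ τ i).BuilderMove q
  · rw [position_succ_of_not_even σ τ hi h h']
    exact Or.inr (τ.legal _ _ h')
  · exact Or.inl ((if_neg h).trans ((if_neg hi).trans (if_neg h')))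

theorem ended_or_card_uncoloured_le (t : ℕ) :
    (position σ τ (2 * t)).Ended ∨ (position σ τ (2 * t)).uncoloured.card + t ≤ n := by
  induction t with
  | zero =>
    right
    have := Finset.card_le_univ (position σ τ (2 * 0)).uncoloured
    rwa [Fintype.card_fin] at this
  | succ t ih =>
    by_cases h : (position σ τ (2 * t)).Ended
    · left
      rwa [position_of_ended σ τ h (by omega)]
    right
    have hc := ih.resolve_left h
    obtain ⟨v, c, hv, hq, -⟩ := painterMove_position σ τ (even_two_mul t) h
    have h1 := card_uncoloured_paint c hv
    rw [paint, ← hq] at h1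
    have h2 : (position σ τ (2 * t + 1 + 1)).uncoloured =
        (position σ τ (2 * t + 1)).uncoloured := by
      rcases position_succ_eq_or_builderMove σ τ (i := 2 * t + 1)
        (Nat.not_even_iff_odd.2 (odd_two_mul_add_one t)) with e | ⟨x, y, -, -, e, -⟩
      · rw [e]
      · rw [e]
        rfl
    rw [show 2 * (t + 1) = 2 * t + 1 + 1 by ring, h2]
    omega

/-- Every play comes to an end, since Painter colours a vertex in every round. -/
theorem exists_ended : ∃ t, (position σ τ (2 * t)).Ended :=
  ⟨n + 1, (ended_or_card_uncoloured_le σ τ (n + 1)).resolve_right (by omega)⟩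

end Play

theorem not_painterWinsPlay_of_builderWinsPlay {σ : PainterStrategy n k} {τ : BuilderStrategy n k}
    (hB : BuilderWinsPlay σ τ) : ¬ PainterWinsPlay σ τ := by
  rintro ⟨i, hi⟩
  obtain ⟨j, hj, hj'⟩ := hB
  have h1 := position_of_ended σ τ (Or.inl hi) (le_max_left i j)
  have h2 := position_of_ended σ τ (Or.inr hj') (le_max_right i j)
  rw [← h1, h2] at hi
  exact hj hi

/-! ### The strategies and their plays -/

open Classical in
/-- Painter moves to a safe position whenever she can. -/
noncomputable def safeStrategy (n k : ℕ) : PainterStrategy n k where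
  move _ p :=
    if h : ∃ q, p.PainterMove q ∧ Safe q then h.choose
    else if h : ∃ q, p.PainterMove q then h.choose
    else p
  legal _ p hp := by
    by_cases h : ∃ q, p.PainterMove q ∧ Safe q
    · rw [dif_pos h]
      exact h.choose_spec.1
    · rw [dif_neg h, dif_pos hp]
      exact hp.choose_spec

open Classical in
/-- Builder moves to a position from which he can force a win whenever he can. -/
noncomputable def forcingStrategy (n k : ℕ) : BuilderStrategy n k where
  move _ p :=
    if h : ∃ q, p.BuilderMove q ∧ BuilderForces q then h.choose
    else if h : ∃ q, p.BuilderMove q then h.choose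
    else p
  legal _ p hp := by
    by_cases h : ∃ q, p.BuilderMove q ∧ BuilderForces q
    · rw [dif_pos h]
      exact h.choose_spec.1
    · rw [dif_neg h, dif_pos hp]
      exact hp.choose_spec

theorem safe_safeStrategy_move {h : List (Position n k)} {p : Position n k}
    (hp : ∃ q, p.PainterMove q ∧ Safe q) : Safe ((safeStrategy n k).move h p) := by
  simp only [safeStrategy, dif_pos hp]
  exact hp.choose_spec.2

theorem builderForces_forcingStrategy_move {h : List (Position n k)} {p : Position n k}
    (hp : ∃ q, p.BuilderMove q ∧ BuilderForces q) :
    BuilderForces ((forcingStrategy n k).move h p) := by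
  simp only [forcingStrategy, dif_pos hp]
  exact hp.choose_spec.2

/-- Painter wins with `k` colours if `n < 2 ^ k`. -/
theorem painterWins_of_lt (hk : 3 ≤ k) (hn : n < 2 ^ k) : PainterWins n k := by
  refine ⟨safeStrategy n k, fun τ => ?_⟩
  have key : ∀ t, ∃ p, Safe p ∧ (position (safeStrategy n k) τ (2 * t) = p ∨
      p.BuilderMove (position (safeStrategy n k) τ (2 * t))) := by
    intro t
    induction t with
    | zero => exact ⟨_, safe_start hk hn, Or.inl rfl⟩
    | succ t ih =>
      obtain ⟨p, hp, hpos⟩ := ih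
      by_cases hend : (position (safeStrategy n k) τ (2 * t)).Ended
      · exact ⟨p, hp, by rwa [position_of_ended (safeStrategy n k) τ hend (by omega)]⟩
      · refine ⟨position (safeStrategy n k) τ (2 * t + 1), ?_,
          position_succ_eq_or_builderMove (safeStrategy n k) τ
            (Nat.not_even_iff_odd.2 (odd_two_mul_add_one t))⟩
        rw [position_succ_of_even (safeStrategy n k) τ (even_two_mul t) hend]
        exact safe_safeStrategy_move
          ((hp.exists_move hpos).resolve_left fun h => hend (Or.inl h))
  obtain ⟨t, ht⟩ := exists_ended (safeStrategy n k) τ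
  obtain ⟨p, hp, hpos⟩ := key t
  refine ⟨2 * t, ht.elim id fun hno => ?_⟩
  exact (hp.exists_move hpos).resolve_right fun ⟨q, hq, _⟩ => hno ⟨q, hq⟩

theorem BuilderForces.isBipartite {p : Position n k} (h : BuilderForces p) :
    p.graph.IsBipartite := by
  cases h with
  | intro _ h => exact h

theorem BuilderForces.not_allColoured {p : Position n k} (h : BuilderForces p) :
    ¬ p.AllColoured := by
  cases h with
  | intro _ _ h => exact h

theorem BuilderForces.exists_move {p q : Position n k} (h : BuilderForces p)
    (hq : p.PainterMove q) : ∃ r, q.BuilderMove r ∧ BuilderForces r := by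
  cases h with
  | intro _ _ _ f legal forces => exact ⟨f q, legal q hq, forces q hq⟩

/-- From a position in which Builder can force a win, the forcing strategy wins, and the graph stays
bipartite. -/
theorem builderWinsPlay_forcingStrategy (h : BuilderForces (start n k)) (σ : PainterStrategy n k) :
    BuilderWinsPlay σ (forcingStrategy n k) ∧
      ∀ i, (position σ (forcingStrategy n k) i).graph.IsBipartite := by
  -- The game may end after a Painter move, in a position to which `BuilderForces` does not apply.
  have key : ∀ t, (position σ (forcingStrategy n k) (2 * t)).graph.IsBipartite ∧
      ¬ (position σ (forcingStrategy n k) (2 * t)).AllColoured ∧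
      ((position σ (forcingStrategy n k) (2 * t)).Ended ∨
        BuilderForces (position σ (forcingStrategy n k) (2 * t))) := by
    intro t
    induction t with
    | zero => exact ⟨h.isBipartite, h.not_allColoured, Or.inr h⟩
    | succ t ih =>
      obtain ⟨h1, h2, h3⟩ := ih
      by_cases hend : (position σ (forcingStrategy n k) (2 * t)).Ended
      · rw [position_of_ended σ _ hend (by omega : 2 * t ≤ 2 * (t + 1))]
        exact ⟨h1, h2, Or.inl hend⟩
      have hq := painterMove_position σ (forcingStrategy n k) (even_two_mul t) hend
      obtain ⟨r, hr, hrf⟩ := (h3.resolve_left hend).exists_move hq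
      by_cases hend' : (position σ (forcingStrategy n k) (2 * t + 1)).Ended
      · rw [show 2 * (t + 1) = 2 * t + 1 + 1 by ring, position_succ_of_ended σ _ hend']
        refine ⟨?_, ?_, Or.inl hend'⟩
        · obtain ⟨v, c, -, e, -⟩ := hq
          rw [e]
          exact h1
        · obtain ⟨u, v, -, -, rfl, -⟩ := hr
          exact hrf.not_allColoured
      · have hodd : ¬ Even (2 * t + 1) := Nat.not_even_iff_odd.2 (odd_two_mul_add_one t)
        have hf : BuilderForces (position σ (forcingStrategy n k) (2 * (t + 1))) := by
          rw [show 2 * (t + 1) = 2 * t + 1 + 1 by ring,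
            position_succ_of_not_even σ _ hodd hend' ⟨r, hr⟩]
          exact builderForces_forcingStrategy_move ⟨r, hr, hrf⟩
        exact ⟨hf.isBipartite, hf.not_allColoured, Or.inr hf⟩
  constructor
  · obtain ⟨t, ht⟩ := exists_ended σ (forcingStrategy n k)
    exact ⟨2 * t, (key t).2.1, ht.resolve_left (key t).2.1⟩
  · intro i
    obtain ⟨t, rfl | rfl⟩ := Nat.even_or_odd' i
    · exact (key t).1
    · by_cases hend : (position σ (forcingStrategy n k) (2 * t)).Ended
      · rw [position_succ_of_ended σ _ hend]
        exact (key t).1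
      · obtain ⟨v, c, -, e, -⟩ :=
          painterMove_position σ (forcingStrategy n k) (even_two_mul t) hend
        rw [e]
        exact (key t).1

theorem two_pow_le_of_le_logb {n k : ℕ} (hn : 0 < n) (hk : (k : ℝ) ≤ 0.01 * Real.logb 2 (n : ℝ)) :
    2 ^ (13 * k) ≤ n := by
  have hk0 : (0 : ℝ) ≤ k := Nat.cast_nonneg k
  have h : ((13 * k : ℕ) : ℝ) ≤ Real.logb 2 (n : ℝ) := by
    push_cast
    linarith
  rw [Real.le_logb_iff_rpow_le (by norm_num) (by exact_mod_cast hn), Real.rpow_natCast] at h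
  exact_mod_cast h

end PainterBuilder

theorem theorem1 (n : ℕ) (hn : 10 ^ 8 < n) :
    (0.01 * Real.logb 2 (n : ℝ) < (PainterBuilder.kMin n : ℝ) ∧
      (PainterBuilder.kMin n : ℝ) ≤ Real.logb 2 (n : ℝ) + 1) ∧
    ∀ k : ℕ, (k : ℝ) ≤ 0.01 * Real.logb 2 (n : ℝ) →
      ∃ τ : PainterBuilder.BuilderStrategy n k, ∀ σ : PainterBuilder.PainterStrategy n k,
        PainterBuilder.BuilderWinsPlay σ τ ∧
        ∀ i : ℕ, (PainterBuilder.position σ τ i).graph.IsBipartite := by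
  have hbuilder : ∀ k : ℕ, (k : ℝ) ≤ 0.01 * Real.logb 2 (n : ℝ) →
      ∀ σ : PainterBuilder.PainterStrategy n k,
        PainterBuilder.BuilderWinsPlay σ (PainterBuilder.forcingStrategy n k) ∧
        ∀ i : ℕ, (PainterBuilder.position σ (PainterBuilder.forcingStrategy n k) i
          ).graph.IsBipartite := fun k hk =>
    PainterBuilder.builderWinsPlay_forcingStrategy
      (PainterBuilder.builderForces_start
        (PainterBuilder.two_pow_le_of_le_logb (by omega) hk))
  have hlog : 3 ≤ Nat.log 2 n + 1 := by
    have : 2 ≤ Nat.log 2 n := Nat.le_log_of_pow_le (by norm_num) (by omega)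
    omega
  have hpainter : PainterBuilder.PainterWins n (Nat.log 2 n + 1) :=
    PainterBuilder.painterWins_of_lt hlog (Nat.lt_pow_succ_log_self (by norm_num) n)
  refine ⟨⟨?_, ?_⟩, fun k hk => ⟨_, hbuilder k hk⟩⟩
  · by_contra! hk
    obtain ⟨σ, hσ⟩ : PainterBuilder.PainterWins n (PainterBuilder.kMin n) :=
      Nat.sInf_mem (s := {k | PainterBuilder.PainterWins n k}) ⟨_, hpainter⟩
    exact PainterBuilder.not_painterWinsPlay_of_builderWinsPlay (hbuilder _ hk σ).1 (hσ _)
  · have h1 : PainterBuilder.kMin n ≤ Nat.log 2 n + 1 := Nat.sInf_le hpainter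
    have h2 : ((Nat.log 2 n : ℕ) : ℝ) ≤ Real.logb 2 (n : ℝ) := by
      exact_mod_cast Real.natLog_le_logb n 2
    have h3 : (PainterBuilder.kMin n : ℝ) ≤ (Nat.log 2 n : ℝ) + 1 := by exact_mod_cast h1
    linarith
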